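/- Let $B$ be a unital commutative complex Banach algebra which is semiprime (that is, $J=\{0\}$ is the only ideal of $B$ such that the product of every pair of elements of $J$ is $0$), and suppose that its character space $\Phi_B$ (the space of non-zero multiplicative linear functionals on $B$, with the weak-$*$ topology) is connected. Let $T : B \to B$ be a bounded unital endomorphism, that is, a bounded linear map with $T(ab)=T(a)T(b)$ for all $a,b\in B$ and $T(1)=1$, and let $\phi : \Phi_B\to\Phi_B$, $\phi(x)=x\circ T$, be the associated selfmap of $\Phi_B$. Let $\rho_e(T)$ denote the essential spectral radius of $T$, i.e. the spectral radius of the class of $T$ in the Calkin algebra $\mathcal L(B)/\mathcal K(B)$ of bounded operators on $B$ modulo compact operators (if $B$ is finite-dimensional, this quotient is the zero algebra and $\rho_e(T)=0$), and call $T$ quasicompact if $\rho_e(T)<1$. Then $T$ is quasicompact if and only if the operators $T^n$ converge in operator norm, as $n\to\infty$, to a rank-one unital endomorphism of $B$. In this case $\phi$ has a unique fixed point $x_0\in\Phi_B$, and the limit of the operators $T^n$ is the endomorphism $b\mapsto \hat b(x_0)\,1$, where $\hat b(x_0)=x_0(b)$ is the Gelfand transform of $b$ at $x_0$. -/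

import Mathlib

open Filter Topology

/-- A commutative ring (or algebra) `B` is *semiprime* if `{0}` is the only ideal `J` of `B` such
that the product of every pair of elements of `J` is `0`. (`B` is unital, so the ring ideals are
exactly the algebra ideals.) -/
def IsSemiprimeAlgebra (B : Type*) [CommRing B] : Prop :=
  ∀ J : Ideal B, (∀ a ∈ J, ∀ b ∈ J, a * b = 0) → J = ⊥

section Calkin

variable (E : Type*) [NormedAddCommGroup E] [NormedSpace ℂ E]

/-- The ideal `K(E)` of compact operators in the algebra `L(E)` of bounded operators on `E`. -/
def compactOperatorIdeal : Ideal (E →L[ℂ] E) where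
  carrier := {K | IsCompactOperator K}
  zero_mem' := isCompactOperator_zero
  add_mem' := fun hK hL => IsCompactOperator.add hK hL
  smul_mem' := fun A _ hK => IsCompactOperator.clm_comp hK A

instance : (compactOperatorIdeal E).IsTwoSided where
  mul_mem_of_left := fun {_} A hK => IsCompactOperator.comp_clm hK A

/-- The Calkin algebra `L(E)/K(E)`. -/
abbrev CalkinAlgebra : Type _ := (E →L[ℂ] E) ⧸ compactOperatorIdeal E

variable {E}

/-- The essential spectral radius of `T`: the spectral radius (the supremum of the moduli of the
points of the spectrum) of the class of `T` in the Calkin algebra. -/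
noncomputable def essentialSpectralRadius (T : E →L[ℂ] E) : ENNReal :=
  spectralRadius ℂ (Ideal.Quotient.mk (compactOperatorIdeal E) T : CalkinAlgebra E)

/-- `T` is quasicompact if its essential spectral radius is less than `1`. -/
def IsQuasicompact (T : E →L[ℂ] E) : Prop :=
  essentialSpectralRadius T < 1

end Calkin

section Selfmap

variable {B : Type*} [NormedCommRing B] [NormedAlgebra ℂ B]

/-- The selfmap `x ↦ x ∘ T` of the character space of `B` associated with a bounded unital
endomorphism `T` of `B`, that is, the restriction of the adjoint of `T`. -/
noncomputable def associatedSelfmap (T : B →A[ℂ] B) (x : WeakDual.characterSpace ℂ B) :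
    WeakDual.characterSpace ℂ B :=
  ⟨StrongDual.toWeakDual ((WeakDual.CharacterSpace.toCLM x).comp T.toContinuousLinearMap), by
    rw [WeakDual.CharacterSpace.eq_set_map_one_map_mul]
    exact ⟨(congrArg x (map_one T)).trans (map_one x),
      fun a b => (congrArg x (map_mul T a b)).trans (map_mul x (T a) (T b))⟩⟩

theorem associatedSelfmap_apply (T : B →A[ℂ] B) (x : WeakDual.characterSpace ℂ B) (b : B) :
    associatedSelfmap T x b = x (T b) := rfl

end Selfmap

/-! If `T` is quasicompact, some power `U = T ^ m` lies within 1/8 of a compact operator, so its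
spectrum outside the open unit disc consists of eigenvalues, and it has no infinite independent
family of eigenvectors for such eigenvalues. Multiplicativity makes every power of an eigenvector an
eigenvector, so an eigenvector with `1 ≤ ‖μ‖` is algebraic over ℂ, hence scalar because `B` is
reduced and its character space connected. Subtracting `b ↦ x b • 1` for any character `x` therefore
leaves spectral radius below 1 (`spectralRadius_sub_character_lt_one`), and the powers of `U`, then
those of `T`, converge. Conversely, a compact limit of the powers puts some `T ^ n` at distance
below 1 from the compact operators. -/

theorem summable_norm_pow_of_spectralRadius_lt_one {A : Type*} [NormedRing A] [NormedAlgebra ℂ A]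
    [CompleteSpace A] {a : A} (ha : spectralRadius ℂ a < 1) : Summable fun n : ℕ => ‖a ^ n‖ := by
  obtain ⟨r, har, hr⟩ := ENNReal.lt_iff_exists_nnreal_btwn.1 ha
  have hr' : r < 1 := by exact_mod_cast hr
  refine Summable.of_norm_bounded_eventually_nat
    (summable_geometric_of_lt_one r.coe_nonneg (by exact_mod_cast hr')) ?_
  filter_upwards [(spectrum.pow_nnnorm_pow_one_div_tendsto_nhds_spectralRadius a).eventually_lt_const
    har, eventually_gt_atTop 0] with n hn hn0
  have h0 : (0 : ℝ) < n := by exact_mod_cast hn0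
  have h := ENNReal.rpow_le_rpow hn.le h0.le
  rw [← ENNReal.rpow_mul, one_div, inv_mul_cancel₀ h0.ne', ENNReal.rpow_one,
    ENNReal.rpow_natCast] at h
  rw [norm_norm]
  exact_mod_cast h

section Quotient

variable {A : Type*} [NormedRing A] (I : Ideal A) [I.IsTwoSided]

/-- The quotient of a normed ring by a closed two-sided ideal is a normed ring. -/
noncomputable abbrev Ideal.Quotient.normedRingOfIsTwoSided [hI : IsClosed (I : Set A)] :
    NormedRing (A ⧸ I) :=
  { Submodule.Quotient.normedAddCommGroup I, Ideal.Quotient.ring I with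
    dist_eq := fun x y => (Submodule.Quotient.normedAddCommGroup I).dist_eq x y
    norm_mul_le := fun x y => by
      refine le_of_forall_pos_le_add fun ε hε => ?_
      have hc : Tendsto (fun δ : ℝ => (‖x‖ + δ) * (‖y‖ + δ)) (𝓝 0) (𝓝 (‖x‖ * ‖y‖)) := by
        have : Continuous (fun δ : ℝ => (‖x‖ + δ) * (‖y‖ + δ)) := by fun_prop
        simpa using this.tendsto 0
      obtain ⟨δ, hδ, hδ0⟩ := (((hc.mono_left nhdsWithin_le_nhds).eventually_lt_const
        (lt_add_of_pos_right _ hε)).and (self_mem_nhdsWithin (s := Set.Ioi 0))).exists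
      obtain ⟨a, rfl, ha⟩ := Submodule.Quotient.norm_mk_lt x hδ0
      obtain ⟨b, rfl, hb⟩ := Submodule.Quotient.norm_mk_lt y hδ0
      calc _ ≤ ‖a * b‖ := Submodule.Quotient.norm_mk_le I (a * b)
        _ ≤ ‖a‖ * ‖b‖ := norm_mul_le a b
        _ ≤ _ := mul_le_mul ha.le hb.le (norm_nonneg _) ((norm_nonneg _).trans ha.le)
        _ ≤ _ := hδ.le }

end Quotient

/-! ### Perturbations of compact operators -/

section Operators

variable {E : Type*} [NormedAddCommGroup E] [NormedSpace ℂ E] [CompleteSpace E]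

theorem isClosed_compactOperatorIdeal : IsClosed (compactOperatorIdeal E : Set (E →L[ℂ] E)) :=
  isClosed_setOfPred_isCompactOperator

theorem IsQuasicompact.exists_norm_pow_sub_lt {T : E →L[ℂ] E} (hT : IsQuasicompact T) {ε : ℝ}
    (hε : 0 < ε) :
    ∃ m : ℕ, 0 < m ∧ ∃ K : E →L[ℂ] E, IsCompactOperator K ∧ ‖T ^ m - K‖ < ε := by
  have hI := isClosed_compactOperatorIdeal (E := E)
  let _ : NormedRing (CalkinAlgebra E) :=
    Ideal.Quotient.normedRingOfIsTwoSided (compactOperatorIdeal E)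
  let _ : NormedAlgebra ℂ (CalkinAlgebra E) :=
    { Ideal.Quotient.algebra ℂ with
      norm_smul_le := fun c x =>
        (Submodule.Quotient.normedSpace (compactOperatorIdeal E) ℂ).norm_smul_le c x }
  have : CompleteSpace (CalkinAlgebra E) :=
    Submodule.Quotient.completeSpace (compactOperatorIdeal E)
  have hs := summable_norm_pow_of_spectralRadius_lt_one
    (a := (Ideal.Quotient.mk (compactOperatorIdeal E) T : CalkinAlgebra E)) hT
  obtain ⟨m, hm, hm0⟩ :=
    ((hs.tendsto_atTop_zero.eventually_lt_const hε).and (eventually_gt_atTop 0)).exists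
  rw [← map_pow] at hm
  obtain ⟨R, hR, hRε⟩ := Submodule.Quotient.norm_mk_lt
    (Ideal.Quotient.mk (compactOperatorIdeal E) (T ^ m)) (sub_pos.2 hm)
  refine ⟨m, hm0, T ^ m - R, ?_, ?_⟩
  · have := (Ideal.Quotient.mk_eq_mk_iff_sub_mem (I := compactOperatorIdeal E) _ _).1 hR
    rw [← neg_mem_iff, neg_sub] at this
    exact this
  · rw [sub_sub_cancel]
    calc ‖R‖ < _ := hRε
      _ = ε := add_sub_cancel _ _

/-- With `u = μ - (A - K)`, invertible by Neumann series, `μ - A = u (1 - u⁻¹ K)`; the Fredholm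
alternative applies to the compact `u⁻¹ K`. -/
theorem exists_eigenvector_of_mem_spectrum {A K : E →L[ℂ] E} (hK : IsCompactOperator K) {μ : ℂ}
    (hμ : ‖A - K‖ < ‖μ‖) (h : μ ∈ spectrum ℂ A) : ∃ v : E, v ≠ 0 ∧ A v = μ • v := by
  have : ‖A - K‖ * ‖(1 : E →L[ℂ] E)‖ < ‖μ‖ :=
    (mul_le_of_le_one_right (norm_nonneg _) ContinuousLinearMap.norm_id_le).trans_lt hμ
  obtain ⟨u, hu⟩ := spectrum.mem_resolventSet_of_norm_lt_mul this
  have hC : IsCompactOperator ((↑u⁻¹ : E →L[ℂ] E) * K) := hK.clm_comp _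
  rcases hC.hasEigenvalue_or_mem_resolventSet one_ne_zero with h1 | h1
  · obtain ⟨v, hv⟩ := h1.exists_hasEigenvector
    refine ⟨v, hv.2, ?_⟩
    have h2 : (↑u⁻¹ : E →L[ℂ] E) (K v) = v := by simpa using hv.apply_eq_smul
    have h3 : (u : E →L[ℂ] E) v = K v := by
      conv_lhs => rw [← h2]
      exact DFunLike.congr_fun u.mul_inv (K v)
    rw [hu] at h3
    simp only [sub_apply, Algebra.algebraMap_eq_smul_one,
      smul_apply, one_apply_eq_self] at h3
    rw [sub_sub_eq_add_sub, sub_eq_iff_eq_add, add_comm, add_left_cancel_iff] at h3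
    exact h3.symm
  · refine absurd ?_ h
    rw [spectrum.mem_resolventSet_iff] at h1
    have h5 : algebraMap ℂ (E →L[ℂ] E) μ - A = u * (algebraMap ℂ _ 1 - ↑u⁻¹ * K) := by
      rw [map_one, mul_sub, mul_one, ← mul_assoc, u.mul_inv, one_mul, hu]; abel
    change IsUnit _
    rw [h5]
    exact u.isUnit.mul h1

-- Riesz's argument survives a small perturbation: unit gaps between the `A (y n)` leave gaps of 1/4
-- between the `K (y n)`, contradicting compactness.
omit [CompleteSpace E] in
theorem not_linearIndependent_of_eigenvectors {A K : E →L[ℂ] E} (hK : IsCompactOperator K)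
    (hAK : ‖A - K‖ ≤ 1 / 8) {v : ℕ → E} {μ : ℕ → ℂ} (hμ : ∀ n, 1 ≤ ‖μ n‖)
    (hv : ∀ n, A (v n) = μ n • v n) : ¬ LinearIndependent ℂ v := by
  intro hli
  let M : ℕ → Submodule ℂ E := fun n => Submodule.span ℂ (v '' Set.Iio n)
  have hmono : Monotone M := fun i j hij =>
    Submodule.span_mono (Set.image_mono (Set.Iio_subset_Iio hij))
  have hvM : ∀ {i n}, i < n → v i ∈ M n := fun hi => Submodule.subset_span ⟨_, hi, rfl⟩
  have hAM : ∀ n, ∀ y ∈ M n, A y ∈ M n := fun n => by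
    refine (Submodule.span_le (p := (M n).comap A.toLinearMap)).2 ?_
    rintro _ ⟨i, hi, rfl⟩
    change A (v i) ∈ M n
    rw [hv]
    exact Submodule.smul_mem _ _ (hvM hi)
  have hAM' : ∀ n, ∀ y ∈ M (n + 1), A y - μ n • y ∈ M n := fun n => by
    refine (Submodule.span_le (p := (M n).comap (A - μ n • 1 : E →L[ℂ] E).toLinearMap)).2 ?_
    rintro _ ⟨i, hi, rfl⟩
    change A (v i) - μ n • v i ∈ M n
    rcases (Nat.lt_succ_iff.1 hi).eq_or_lt with rfl | hi
    · simp [hv]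
    · rw [hv]
      exact sub_mem (Submodule.smul_mem _ _ (hvM hi)) (Submodule.smul_mem _ _ (hvM hi))
  have hfin : ∀ n, FiniteDimensional ℂ (M n) := fun n =>
    FiniteDimensional.span_of_finite ℂ ((Set.finite_Iio n).image v)
  -- Two such vectors differ by at most 6 in norm, so `A - K` contributes at most 6/8 and 1/4 of the
  -- gap remains.
  have hex : ∀ n, ∃ y ∈ M (n + 1), ‖y‖ ≤ 3 ∧ ∀ z ∈ M n, 1 ≤ ‖y - z‖ := fun n => by
    obtain ⟨y, hy, hyz⟩ := riesz_lemma_of_norm_lt (𝕜 := ℂ) (c := 2) (R := 3) (by norm_num)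
      (by norm_num) (F := (M n).comap (M (n + 1)).subtype)
      (Submodule.closed_of_finiteDimensional _)
      ⟨⟨v n, hvM n.lt_succ_self⟩, fun h => hli.notMem_span_image (s := Set.Iio n) (by simp) h⟩
    exact ⟨y, y.2, hy, fun z hz => hyz ⟨z, hmono n.le_succ hz⟩ hz⟩
  choose y hyM hy3 hyz using hex
  have hA : ∀ {k n}, k < n → 1 ≤ ‖A (y n) - A (y k)‖ := fun {k n} hkn => by
    have hμn : μ n ≠ 0 := norm_pos_iff.1 (one_pos.trans_le (hμ n))
    have hz : A (y k) - (A (y n) - μ n • y n) ∈ M n :=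
      sub_mem (hmono hkn (hAM _ _ (hyM k))) (hAM' n _ (hyM n))
    have h := hyz n _ (Submodule.smul_mem _ (μ n)⁻¹ hz)
    have : A (y n) - A (y k) =
        μ n • (y n - (μ n)⁻¹ • (A (y k) - (A (y n) - μ n • y n))) := by
      rw [smul_sub, smul_inv_smul₀ hμn]; abel
    rw [this, norm_smul]
    exact one_le_mul_of_one_le_of_one_le (hμ n) h
  have hKy : ∀ {k n}, k < n → 1 / 4 ≤ ‖K (y n) - K (y k)‖ := fun {k n} hkn => by
    have h1 : A (y n) - A (y k) = (K (y n) - K (y k)) + (A - K) (y n - y k) := by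
      simp only [map_sub, sub_apply]; abel
    have h2 : ‖(A - K) (y n - y k)‖ ≤ 1 / 8 * 6 :=
      ((A - K).le_opNorm _).trans (mul_le_mul hAK
        ((norm_sub_le _ _).trans (by linarith [hy3 n, hy3 k])) (norm_nonneg _) (by norm_num))
    have h3 := hA hkn
    rw [h1] at h3
    linarith [norm_add_le (K (y n) - K (y k)) ((A - K) (y n - y k))]
  obtain ⟨C, hC, hC'⟩ := hK.image_closedBall_subset_compact (f := K.toLinearMap) 3
  obtain ⟨w, -, ψ, hψ, hw⟩ := hC.tendsto_subseq
    (x := fun n => K (y n)) (fun n => hC' ⟨y n, by simpa using hy3 n, rfl⟩)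
  obtain ⟨N, hN⟩ := Metric.cauchySeq_iff'.1 hw.cauchySeq (1 / 4) (by norm_num)
  have := hN (N + 1) N.le_succ
  rw [dist_eq_norm] at this
  exact absurd (hKy (hψ N.lt_succ_self)) (not_le.2 this)

end Operators

theorem IsSemiprimeAlgebra.isReduced {B : Type*} [CommRing B] (hB : IsSemiprimeAlgebra B) :
    IsReduced B := by
  refine (isReduced_iff_pow_one_lt 2 one_lt_two).2 fun a ha => ?_
  have h := hB (Ideal.span {a}) ?_
  · simpa using h
  · intro b hb c hc
    obtain ⟨b, rfl⟩ := Ideal.mem_span_singleton'.1 hb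
    obtain ⟨c, rfl⟩ := Ideal.mem_span_singleton'.1 hc
    rw [mul_mul_mul_comm, ← sq a, ha, mul_zero]

/-! ### Integral elements and connectedness -/

section Integral

variable {B : Type*} [NormedCommRing B] [NormedAlgebra ℂ B] [CompleteSpace B]

open Polynomial in
/-- In a reduced commutative Banach algebra with connected character space, the only elements
which are integral over `ℂ` are the scalars. -/
theorem exists_eq_algebraMap_of_isIntegral [IsReduced B]
    [ConnectedSpace (WeakDual.characterSpace ℂ B)] {b : B} (hb : IsIntegral ℂ b) :
    ∃ c : ℂ, b = algebraMap ℂ B c := by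
  obtain ⟨p, hp, hpb⟩ := hb
  rw [← aeval_def] at hpb
  let g : WeakDual.characterSpace ℂ B → ℂ := fun x => x b
  have hg : Continuous g := (WeakDual.gelfandTransform ℂ B b).continuous
  have hgp : ∀ x, p.IsRoot (g x) := fun x => by
    have h : x (aeval b p) = aeval (x b) p :=
      (aeval_algHom_apply (WeakDual.CharacterSpace.toAlgHom x) b p).symm
    rw [hpb, map_zero, coe_aeval_eq_eval] at h
    exact h.symm
  have hfin : (Set.range g).Finite :=
    (p.rootSet_finite ℂ).subset (by
      rintro _ ⟨x, rfl⟩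
      exact (mem_rootSet_of_ne hp.ne_zero).2 (by simpa using hgp x))
  -- The Gelfand transform of `b` takes values among the roots of `p`, and a connected finite set in
  -- ℂ has at most one point.
  have hsub : (Set.range g).Subsingleton :=
    Set.not_nontrivial_iff.1 fun h =>
    (isPreconnected_range hg).infinite_of_nontrivial h hfin
  obtain ⟨x₀⟩ := (inferInstance : Nonempty (WeakDual.characterSpace ℂ B))
  have hconst : ∀ x : WeakDual.characterSpace ℂ B, x b = g x₀ := fun x => hsub ⟨x, rfl⟩ ⟨x₀, rfl⟩
  refine ⟨g x₀, ?_⟩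
  -- No character kills `q(b)`, so it is a unit; hence `b - g x₀` is nilpotent, and zero by
  -- reducedness.
  obtain ⟨q, hq, hqx⟩ := exists_eq_pow_rootMultiplicity_mul_and_not_dvd p hp.ne_zero (g x₀)
  rw [dvd_iff_isRoot] at hqx
  have hu : IsUnit (aeval b q) := by
    by_contra h
    obtain ⟨x, hx⟩ := WeakDual.CharacterSpace.exists_apply_eq_zero h
    have h' : x (aeval b q) = aeval (x b) q :=
      (aeval_algHom_apply (WeakDual.CharacterSpace.toAlgHom x) b q).symm
    rw [hx, hconst x, coe_aeval_eq_eval] at h'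
    exact hqx h'.symm
  rw [hq, map_mul, hu.mul_left_eq_zero, map_pow] at hpb
  have := eq_zero_of_pow_eq_zero hpb
  rwa [map_sub, aeval_X, aeval_C, sub_eq_zero] at this

end Integral

/-! ### Endomorphisms close to a compact operator -/

section Endomorphism

variable {B : Type*} [NormedCommRing B] [NormedAlgebra ℂ B] [CompleteSpace B] [IsReduced B]
  [ConnectedSpace (WeakDual.characterSpace ℂ B)] {U K : B →L[ℂ] B} (u : B →ₐ[ℂ] B)
  (hu : ∀ b, U b = u b) (hK : IsCompactOperator K) (hUK : ‖U - K‖ ≤ 1 / 8)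

include hu hK hUK in
theorem exists_eq_algebraMap_of_eigenvector {a : B} {μ : ℂ} (hμ : 1 ≤ ‖μ‖) (ha : U a = μ • a) :
    ∃ c : ℂ, a = algebraMap ℂ B c := by
  have hli : ¬ LinearIndependent ℂ fun n : ℕ => a ^ n :=
    not_linearIndependent_of_eigenvectors hK hUK (μ := fun n => μ ^ n)
      (fun n => by rw [norm_pow]; exact one_le_pow₀ hμ)
      (fun n => by rw [hu, map_pow, ← hu, ha, smul_pow])
  refine exists_eq_algebraMap_of_isIntegral (isAlgebraic_iff_isIntegral.1 ?_)
  by_contra htr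
  apply hli
  have := (Polynomial.basisMonomials ℂ).linearIndependent.map'
    (Polynomial.aeval (R := ℂ) a).toLinearMap
    (LinearMap.ker_eq_bot.2 (transcendental_iff_injective.1 htr))
  rwa [show ⇑(Polynomial.aeval a).toLinearMap ∘ ⇑(Polynomial.basisMonomials ℂ) =
    fun n : ℕ => a ^ n by ext; simp] at this

-- Rules out a Jordan block at 1: iterating gives `b + n c`, while the characters `x ∘ u ^ n` are
-- bounded at `b` uniformly in `n`.
omit [IsReduced B] in
include hu in
theorem eq_zero_of_apply_eq_add_algebraMap {b : B} {c : ℂ}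
    (hb : U b = b + algebraMap ℂ B c) : c = 0 := by
  obtain ⟨x⟩ := (inferInstance : Nonempty (WeakDual.characterSpace ℂ B))
  have hn : ∀ n : ℕ, (u ^ n) b = b + algebraMap ℂ B (n * c) := fun n => by
    induction n with
    | zero => simp
    | succ n ih =>
      rw [pow_succ, AlgHom.mul_apply, ← hu, hb, map_add, ih, AlgHom.commutes, add_assoc, ← map_add]
      push_cast; ring_nf
  have hbd : ∀ n : ℕ, n * ‖c‖ ≤ ‖b‖ * ‖(1 : B)‖ + ‖x b‖ := fun n => by
    have h := AlgHom.norm_apply_le_self_mul_norm_one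
      ((WeakDual.CharacterSpace.toAlgHom x).comp (u ^ n)) b
    have h' : ((WeakDual.CharacterSpace.toAlgHom x).comp (u ^ n)) b = x b + n * c := by
      rw [AlgHom.comp_apply, hn, map_add, AlgHom.commutes]; rfl
    rw [h'] at h
    have h3 := norm_sub_le (x b + n * c) (x b)
    rw [add_sub_cancel_left, norm_mul, Complex.norm_natCast] at h3
    linarith
  by_contra hc
  obtain ⟨n, hn⟩ := exists_nat_gt ((‖b‖ * ‖(1 : B)‖ + ‖x b‖) / ‖c‖)
  rw [div_lt_iff₀ (norm_pos_iff.2 hc)] at hn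
  exact (hbd n).not_gt hn

include hu hK hUK in
/-- Subtracting from `U` the rank-one operator `b ↦ x b • 1` removes the eigenvalue `1`, and with it
all the spectrum outside the open unit disc. -/
theorem spectralRadius_sub_character_lt_one (x : WeakDual.characterSpace ℂ B) :
    spectralRadius ℂ (U - (WeakDual.CharacterSpace.toCLM x).smulRight (1 : B)) < 1 := by
  set P : B →L[ℂ] B := (WeakDual.CharacterSpace.toCLM x).smulRight (1 : B) with hP
  have hPa : ∀ b, P b = algebraMap ℂ B (x b) := fun b => (Algebra.algebraMap_eq_smul_one _).symm
  have : Nontrivial B := not_subsingleton_iff_nontrivial.1 fun _ =>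
    IsEmpty.false x
  refine spectrum.spectralRadius_lt_of_forall_lt (r := 1) _ fun μ hμ => ?_
  by_contra hμ1
  replace hμ1 : 1 ≤ ‖μ‖ := by exact_mod_cast not_lt.1 hμ1
  have hPc : IsCompactOperator P :=
    (isCompactOperator_of_locallyCompactSpace_rng ((1 : ℂ →L[ℂ] ℂ).smulRight (1 : B))).comp_clm
      (WeakDual.CharacterSpace.toCLM x)
  have hKP : IsCompactOperator (K - P : B →L[ℂ] B) := hK.sub hPc
  obtain ⟨v, hv0, hv⟩ := exists_eigenvector_of_mem_spectrum hKP (μ := μ) (A := U - P)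
    (by rw [sub_sub_sub_cancel_right]; linarith) hμ
  rw [sub_apply, hPa, sub_eq_iff_eq_add] at hv
  have hU1 : ∀ c, U (algebraMap ℂ B c) = algebraMap ℂ B c := fun c => by rw [hu, AlgHom.commutes]
  have hinj := (algebraMap ℂ B).injective
  by_cases h1 : μ = 1
  · subst h1
    rw [one_smul] at hv
    have hx := eq_zero_of_apply_eq_add_algebraMap u hu hv
    rw [hx, map_zero, add_zero] at hv
    obtain ⟨c, rfl⟩ := exists_eq_algebraMap_of_eigenvector u hu hK hUK (μ := 1) (by simp)
      (hv.trans (one_smul _ _).symm)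
    rw [AlgHomClass.commutes] at hx
    exact hv0 (by rw [show c = 0 from hx, map_zero])
  · have hμ' : μ - 1 ≠ 0 := sub_ne_zero.2 h1
    -- Since `U v = μ v + x v`, shifting `v` by the scalar `x v / (μ - 1)` gives an eigenvector of
    -- `U`; so `v` is itself a scalar, and `U - P` kills scalars.
    obtain ⟨c, hc⟩ := exists_eq_algebraMap_of_eigenvector u hu hK hUK (μ := μ) hμ1
      (a := v + algebraMap ℂ B (x v / (μ - 1))) (by
        rw [map_add, hU1, hv, smul_add, add_assoc, ← map_add, Algebra.smul_def μ (algebraMap _ _ _),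
          ← map_mul]
        congr 2
        field_simp
        ring)
    rw [← eq_sub_iff_add_eq, ← map_sub] at hc
    generalize c - x v / (μ - 1) = d at hc
    subst hc
    rw [hU1, AlgHomClass.commutes, Algebra.smul_def, ← map_mul, ← map_add] at hv
    have hd : d = μ * d + d := hinj hv
    have hd0 : μ * d = 0 := by linear_combination -hd
    have hμ0 : μ ≠ 0 := norm_pos_iff.1 (one_pos.trans_le hμ1)
    rw [(mul_eq_zero.1 hd0).resolve_left hμ0, map_zero] at hv0
    exact hv0 rfl

-- With `V = U - f ⊗ 1`, the identity `U 1 = 1` gives `U ^ n = V ^ n + (∑ j < n, f ∘ V ^ j) ⊗ 1`,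
-- and the powers of `V` are summable in norm.
include hu hK hUK in
theorem exists_tendsto_pow_smulRight_one :
    ∃ g : B →L[ℂ] ℂ, Tendsto (fun n : ℕ => U ^ n) atTop (𝓝 (g.smulRight (1 : B))) := by
  obtain ⟨x⟩ := (inferInstance : Nonempty (WeakDual.characterSpace ℂ B))
  let f : B →L[ℂ] ℂ := WeakDual.CharacterSpace.toCLM x
  let V : B →L[ℂ] B := U - f.smulRight (1 : B)
  have hV := summable_norm_pow_of_spectralRadius_lt_one
    (spectralRadius_sub_character_lt_one u hu hK hUK x)
  have hs : Summable fun n : ℕ => f.comp (V ^ n) :=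
    .of_norm_bounded (hV.mul_left ‖f‖) fun n => f.opNorm_comp_le (V ^ n)
  have hU1 : ∀ n : ℕ, (U ^ n) 1 = 1 := fun n => by
    induction n with
    | zero => rfl
    | succ n ih => rw [pow_succ, mul_apply_eq_comp, hu, map_one, ih]
  have hn : ∀ n : ℕ, U ^ n = V ^ n + (∑ j ∈ Finset.range n, f.comp (V ^ j)).smulRight (1 : B) :=
      fun n => by
    induction n with
    | zero => ext; simp
    | succ n ih =>
      have hUV : U = V + f.smulRight (1 : B) := (sub_add_cancel _ _).symm
      ext b
      have h1 : (U ^ (n + 1)) b = (U ^ n) (V b) + f b • (1 : B) := by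
        rw [pow_succ, mul_apply_eq_comp]
        conv_lhs => enter [2]; rw [hUV]
        rw [add_apply, map_add, ContinuousLinearMap.smulRight_apply, map_smul, hU1]
      rw [h1, ih, Finset.sum_range_succ']
      simp only [add_apply, ContinuousLinearMap.smulRight_apply, sum_apply,
        ContinuousLinearMap.comp_apply, pow_succ, mul_apply_eq_comp, pow_zero,
        one_apply_eq_self, add_smul, add_assoc]
  refine ⟨∑' n, f.comp (V ^ n), ?_⟩
  simp_rw [hn]
  have h0 : Tendsto (fun n : ℕ => V ^ n) atTop (𝓝 0) :=
    tendsto_zero_iff_norm_tendsto_zero.2 hV.tendsto_atTop_zero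
  have h1 : Tendsto (fun n : ℕ => (∑ j ∈ Finset.range n, f.comp (V ^ j)).smulRight (1 : B)) atTop
      (𝓝 ((∑' n, f.comp (V ^ n)).smulRight (1 : B))) :=
    (((ContinuousLinearMap.smulRightL ℂ B B).flip (1 : B)).continuous.tendsto _).comp
      hs.hasSum.tendsto_sum_nat
  simpa only [zero_add] using h0.add h1

end Endomorphism

/-! ### From convergence to quasicompactness -/

section Converse

variable {E : Type*} [NormedAddCommGroup E] [NormedSpace ℂ E]

theorem isCompactOperator_of_rank_eq_one {S : E →L[ℂ] E}
    (hS : LinearMap.rank S.toLinearMap = 1) : IsCompactOperator S := by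
  have : FiniteDimensional ℂ S.toLinearMap.range := Module.finite_of_rank_eq_one hS
  have : LocallyCompactSpace S.toLinearMap.range :=
    have := FiniteDimensional.proper ℂ S.toLinearMap.range
    inferInstance
  exact (isCompactOperator_of_locallyCompactSpace_rng S.toLinearMap.range.subtypeL).comp_clm
    (S.codRestrict S.toLinearMap.range fun x => LinearMap.mem_range_self S.toLinearMap x)

theorem isQuasicompact_of_tendsto [CompleteSpace E] [Nontrivial E] {T S : E →L[ℂ] E}
    (hS : IsCompactOperator S) (hT : Tendsto (fun n : ℕ => T ^ n) atTop (𝓝 S)) :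
    IsQuasicompact T := by
  obtain ⟨n, hn, hn0⟩ := (((tendsto_iff_norm_sub_tendsto_zero.1 hT).eventually_lt_const
    one_pos).and (eventually_ne_atTop 0)).exists
  let I := compactOperatorIdeal E
  have h1 : spectralRadius ℂ (Ideal.Quotient.mk I T ^ n) ≤ ‖T ^ n - S‖₊ := by
    have h2 : Ideal.Quotient.mk I T ^ n = Ideal.Quotient.mkₐ ℂ I (T ^ n - S) := by
      have hSI : Ideal.Quotient.mk I S = 0 := Ideal.Quotient.eq_zero_iff_mem.2 hS
      rw [Ideal.Quotient.mkₐ_eq_mk, map_sub, hSI, sub_zero, map_pow]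
    rw [h2]
    -- Spectra shrink under the quotient map, so the norm on `L(E)` suffices.
    exact (iSup_le_iSup_of_subset (AlgHom.spectrum_apply_subset _ _)).trans
      (spectrum.spectralRadius_le_nnnorm (T ^ n - S))
  have h3 := (spectrum.spectralRadius_pow_le _ n hn0).trans h1
  change spectralRadius ℂ (Ideal.Quotient.mk I T) < 1
  by_contra h
  have h4 := (one_le_pow₀ (n := n) (not_lt.1 h)).trans h3
  exact hn.not_ge (by exact_mod_cast h4)

end Converse

/-- Divide `n` by `m`: the finitely many remainder powers are bounded and fix `s` by left
multiplication. -/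
theorem tendsto_pow_of_tendsto_pow_pow {A : Type*} [NormedRing A] {a s : A} {m : ℕ} (hm : 0 < m)
    (h : Tendsto (fun n : ℕ => (a ^ m) ^ n) atTop (𝓝 s)) (has : a * s = s) :
    Tendsto (fun n : ℕ => a ^ n) atTop (𝓝 s) := by
  rw [tendsto_iff_norm_sub_tendsto_zero] at h ⊢
  have hs : ∀ r : ℕ, a ^ r * s = s := fun r => by
    induction r with
    | zero => simp
    | succ r ih => rw [pow_succ, mul_assoc, has, ih]
  refine squeeze_zero (fun _ => norm_nonneg _) (fun n => ?_)
    (by simpa using ((h.comp (Nat.tendsto_div_const_atTop hm.ne')).const_mul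
      (∑ r ∈ Finset.range m, ‖a ^ r‖)))
  calc ‖a ^ n - s‖ = ‖a ^ (n % m) * ((a ^ m) ^ (n / m) - s)‖ := by
        rw [mul_sub, hs, ← pow_mul, ← pow_add, Nat.mod_add_div]
    _ ≤ ‖a ^ (n % m)‖ * ‖(a ^ m) ^ (n / m) - s‖ := norm_mul_le _ _
    _ ≤ _ := mul_le_mul_of_nonneg_right
        (Finset.single_le_sum (f := fun r => ‖a ^ r‖) (fun _ _ => norm_nonneg _)
          (Finset.mem_range.2 (Nat.mod_lt n hm))) (norm_nonneg _)

/-! ### The limit endomorphism and the fixed point -/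

section Limit

variable {B : Type*} [NormedCommRing B] [NormedAlgebra ℂ B]

theorem pow_toContinuousLinearMap_apply (T : B →A[ℂ] B) (n : ℕ) (b : B) :
    (T.toContinuousLinearMap ^ n) b = ((T : B →ₐ[ℂ] B) ^ n) b := by
  induction n generalizing b with
  | zero => rfl
  | succ n ih => rw [pow_succ, mul_apply_eq_comp, ih, pow_succ]; rfl

theorem IsQuasicompact.exists_tendsto_pow [CompleteSpace B] [IsReduced B]
    [ConnectedSpace (WeakDual.characterSpace ℂ B)] {T : B →A[ℂ] B}
    (hT : IsQuasicompact T.toContinuousLinearMap) :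
    ∃ g : B →L[ℂ] ℂ, Tendsto (fun n : ℕ => T.toContinuousLinearMap ^ n) atTop
      (𝓝 (g.smulRight (1 : B))) := by
  obtain ⟨m, hm, K, hK, hTK⟩ := hT.exists_norm_pow_sub_lt (show (0 : ℝ) < 1 / 8 by norm_num)
  obtain ⟨g, hg⟩ := exists_tendsto_pow_smulRight_one ((T : B →ₐ[ℂ] B) ^ m)
    (pow_toContinuousLinearMap_apply T m) hK hTK.le
  refine ⟨g, tendsto_pow_of_tendsto_pow_pow hm hg ?_⟩
  ext b
  change T (g b • 1) = g b • 1
  rw [map_smul, map_one]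

/-- A limit of the powers of a bounded unital endomorphism is a bounded unital endomorphism. -/
theorem exists_eq_toContinuousLinearMap_of_tendsto_pow {T : B →A[ℂ] B} {S : B →L[ℂ] B}
    (h : Tendsto (fun n : ℕ => T.toContinuousLinearMap ^ n) atTop (𝓝 S)) :
    ∃ S' : B →A[ℂ] B, S'.toContinuousLinearMap = S := by
  have hb : ∀ b, Tendsto (fun n : ℕ => ((T : B →ₐ[ℂ] B) ^ n) b) atTop (𝓝 (S b)) := fun b => by
    simp_rw [← pow_toContinuousLinearMap_apply]
    exact ((ContinuousLinearMap.apply ℂ B b).continuous.tendsto S).comp h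
  have h1 : S 1 = 1 := tendsto_nhds_unique (hb 1) (by simp_rw [map_one]; exact tendsto_const_nhds)
  have hmul : ∀ a b, S (a * b) = S a * S b := fun a b =>
    tendsto_nhds_unique (hb (a * b)) (by simp_rw [map_mul]; exact (hb a).mul (hb b))
  exact ⟨⟨AlgHom.ofLinearMap S.toLinearMap h1 hmul, S.continuous⟩, rfl⟩

end Limit

theorem theorem2p2 {B : Type*} [NormedCommRing B] [NormedAlgebra ℂ B] [CompleteSpace B]
    (hB : IsSemiprimeAlgebra B) (hconn : ConnectedSpace (WeakDual.characterSpace ℂ B))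
    (T : B →A[ℂ] B) :
    (IsQuasicompact T.toContinuousLinearMap ↔
      ∃ S : B →A[ℂ] B, LinearMap.rank S.toContinuousLinearMap.toLinearMap = 1 ∧
        Tendsto (fun n : ℕ => T.toContinuousLinearMap ^ n) atTop (𝓝 S.toContinuousLinearMap)) ∧
    (IsQuasicompact T.toContinuousLinearMap →
      ∃ x₀ : WeakDual.characterSpace ℂ B,
        Function.IsFixedPt (associatedSelfmap T) x₀ ∧
        (∀ x : WeakDual.characterSpace ℂ B,
          Function.IsFixedPt (associatedSelfmap T) x → x = x₀) ∧
        ∀ S : B →L[ℂ] B,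
          Tendsto (fun n : ℕ => T.toContinuousLinearMap ^ n) atTop (𝓝 S) →
            ∀ b : B, S b = WeakDual.gelfandTransform ℂ B b x₀ • (1 : B)) := by
  have := hB.isReduced
  obtain ⟨x⟩ := (inferInstance : Nonempty (WeakDual.characterSpace ℂ B))
  have : Nontrivial B := not_subsingleton_iff_nontrivial.1 fun _ => IsEmpty.false x
  refine ⟨⟨fun hT => ?_, fun ⟨S, hS, hTS⟩ =>
    isQuasicompact_of_tendsto (isCompactOperator_of_rank_eq_one hS) hTS⟩, fun hT => ?_⟩
  · obtain ⟨g, hg⟩ := hT.exists_tendsto_pow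
    obtain ⟨S, hS⟩ := exists_eq_toContinuousLinearMap_of_tendsto_pow hg
    refine ⟨S, ?_, hS ▸ hg⟩
    have hSb : ∀ b, S b = g b • (1 : B) := fun b => DFunLike.congr_fun hS b
    refine rank_eq_one_iff.2 ⟨⟨1, 1, map_one S⟩, fun h => one_ne_zero (congrArg Subtype.val h), ?_⟩
    rintro ⟨_, b, rfl⟩
    exact ⟨g b, Subtype.ext (hSb b).symm⟩
  · obtain ⟨g, hg⟩ := hT.exists_tendsto_pow
    obtain ⟨S, hS⟩ := exists_eq_toContinuousLinearMap_of_tendsto_pow hg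
    have hSb : ∀ b, S b = g b • (1 : B) := fun b => DFunLike.congr_fun hS b
    have hy : ∀ y : WeakDual.characterSpace ℂ B, ∀ b, y (S b) = g b := fun y b => by
      rw [hSb, map_smul, map_one, smul_eq_mul, mul_one]
    have hb : ∀ b, Tendsto (fun n : ℕ => (T.toContinuousLinearMap ^ n) b) atTop (𝓝 (S b)) :=
      fun b => by
        rw [hSb]
        exact ((ContinuousLinearMap.apply ℂ B b).continuous.tendsto _).comp hg
    have hST : ∀ b, S (T b) = S b := fun b => by
      refine tendsto_nhds_unique (hb (T b)) (((hb b).comp (tendsto_add_atTop_nat 1)).congr fun n => ?_)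
      simp only [Function.comp_apply, pow_succ, mul_apply_eq_comp]
      rfl
    -- The fixed point `x ∘ S` equals `g` whatever `x` is. A fixed `y` is constant along `T ^ n b`,
    -- so in the limit `y b = y (S b) = g b`.
    refine ⟨associatedSelfmap S x, ?_, fun y hyT => ?_, fun S' hS' b => ?_⟩
    · refine WeakDual.CharacterSpace.ext fun b => ?_
      rw [associatedSelfmap_apply, associatedSelfmap_apply, associatedSelfmap_apply, hST]
    · refine WeakDual.CharacterSpace.ext fun b => ?_
      rw [associatedSelfmap_apply, hy, ← hy y]
      have hyn : ∀ n : ℕ, y ((T.toContinuousLinearMap ^ n) b) = y b := fun n => by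
        induction n with
        | zero => rfl
        | succ n ih =>
          rw [pow_succ', mul_apply_eq_comp, ← ih]
          exact DFunLike.congr_fun hyT _
      refine (tendsto_nhds_unique (((map_continuous y).tendsto _).comp (hb b))
        (tendsto_const_nhds.congr fun n => (hyn n).symm)).symm
    · rw [tendsto_nhds_unique hS' hg, WeakDual.gelfandTransform_apply_apply,
        associatedSelfmap_apply, hy]
      rfl
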